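/- Let $P,Q$ be orthogonal projections on a complex Hilbert space $H$, with ranges $R(P),R(Q)$ and nullspaces $N(P),N(Q)$. An operator $T$ on $H$ is called Schmidt decomposable if $T=\sum_n s_n\, f_n\otimes g_n$ (strongly convergent), where $(f_n)$ and $(g_n)$ are orthonormal systems indexed by a common (finite or infinite, not necessarily countable) set, the numbers $s_n>0$ are the singular values of $T$, and $(f\otimes g)(h)=\langle h,g\rangle f$ with $\langle\cdot,\cdot\rangle$ linear in the first variable. An operator is called diagonalizable if there is an orthonormal basis of the Hilbert space consisting of its eigenvectors. The generic part of the pair is $$H'=\big((R(P)\cap R(Q))\oplus(N(P)\cap N(Q))\oplus(R(P)\cap N(Q))\oplus(N(P)\cap R(Q))\big)^\perp .$$ A Halmos model of the pair consists of a Hilbert space $L$, a unitary isomorphism $H'\simeq L\times L$ and an operator $X$ on $L$ (the angle operator) with $0\le X\le \pi/2$, such that $X$, $C=\cos X$ and $S=\sin X$ have trivial nullspaces and the isomorphism carries the restrictions of $P$ and $Q$ to $H'$ to $$\begin{pmatrix}1&0\\0&0\end{pmatrix}\quad\text{and}\quad\begin{pmatrix}C^2&CS\\CS&S^2\end{pmatrix}.$$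 A Halmos model of $P,Q$ exists, and for each Halmos model of $P,Q$ the following are equivalent: 1. $PQ$ is Schmidt decomposable; 2. the commutator $[P,Q]=PQ-QP$ is diagonalizable; 3. the angle operator $X$ is diagonalizable. Moreover, if $PQ$ has a decomposition as above with singular values $s_n$, then $\pm i\, s_n\sqrt{1-s_n^2}$ are eigenvalues of $[P,Q]$ for every $n$, and $[P,Q]$ has no other eigenvalue except possibly $0$. -/

import Mathlib

open scoped InnerProductSpace ComplexOrder

namespace TwoProjections

universe u

section Decompositions

variable {H : Type u} [NormedAddCommGroup H] [InnerProductSpace ℂ H]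

/-- `T = ∑ᵢ sᵢ fᵢ ⊗ gᵢ` (strong convergence) with orthonormal systems `f`, `g` and positive numbers
`sᵢ` (the singular values of `T`), where `(f ⊗ g) h = ⟨h, g⟩ f` (linear in `h`).  In a separable
space such a system is finite or a sequence. -/
structure IsSchmidtDecomposition {ι : Type*} (T : H →L[ℂ] H) (f g : ι → H) (s : ι → ℝ) :
    Prop where
  orthonormal_left : Orthonormal ℂ f
  orthonormal_right : Orthonormal ℂ g
  pos : ∀ i, 0 < s i
  hasSum : ∀ h : H, HasSum (fun i => ((s i : ℝ) : ℂ) • (⟪g i, h⟫_ℂ • f i)) (T h)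

/-- `T` has a singular value decomposition. -/
def SchmidtDecomposable (T : H →L[ℂ] H) : Prop :=
  ∃ (ι : Type u) (f g : ι → H) (s : ι → ℝ), IsSchmidtDecomposition T f g s

/-- There is an orthonormal basis (in the Hilbert space sense) of eigenvectors of `T`. -/
def Diagonalizable (T : H →L[ℂ] H) : Prop :=
  ∃ (ι : Type u) (b : HilbertBasis ι ℂ H) (d : ι → ℂ), ∀ i, T (b i) = d i • b i

/-- The generic part of `P`, `Q`: the orthogonal complement of the sum of the four subspaces
`R(P) ∩ R(Q)`, `N(P) ∩ N(Q)`, `R(P) ∩ N(Q)` and `N(P) ∩ R(Q)`. -/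
noncomputable def genericPart (P Q : H →L[ℂ] H) : Submodule ℂ H :=
  ((P.range ⊓ Q.range) ⊔ (P.ker ⊓ Q.ker) ⊔ (P.range ⊓ Q.ker) ⊔ (P.ker ⊓ Q.range))ᗮ

end Decompositions

/-- A Halmos model of the pair `P`, `Q`: a Hilbert space `L`, a unitary `W` from the generic part
onto the Hilbert space sum `L × L`, and an operator `0 ≤ X ≤ π/2` on `L` (the angle operator) such
that `W` carries the reductions of `P` and `Q` to `[1, 0; 0, 0]` and `[C², CS; CS, S²]`, where
`C = cos X` and `S = sin X` are given by the continuous functional calculus; `X`, `C`, `S` have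
trivial nullspaces. -/
structure HalmosModel {H : Type u} [NormedAddCommGroup H] [InnerProductSpace ℂ H]
    (P Q : H →L[ℂ] H) where
  L : Type u
  [instNormedAddCommGroup : NormedAddCommGroup L]
  [instInnerProductSpace : InnerProductSpace ℂ L]
  [instCompleteSpace : CompleteSpace L]
  W : genericPart P Q ≃ₗᵢ[ℂ] WithLp 2 (L × L)
  X : L →L[ℂ] L
  X_nonneg : 0 ≤ X
  X_le : X ≤ ((Real.pi / 2 : ℝ) : ℂ) • (1 : L →L[ℂ] L)
  ker_X : X.ker = ⊥
  ker_cos : (cfc Real.cos X).ker = ⊥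
  ker_sin : (cfc Real.sin X).ker = ⊥
  P_apply : ∀ x y : L,
    P (W.symm (WithLp.toLp 2 (x, y)) : H) = (W.symm (WithLp.toLp 2 (x, 0)) : H)
  Q_apply : ∀ x y : L,
    Q (W.symm (WithLp.toLp 2 (x, y)) : H) =
      (W.symm (WithLp.toLp 2
        ((cfc Real.cos X * cfc Real.cos X) x + (cfc Real.cos X * cfc Real.sin X) y,
         (cfc Real.cos X * cfc Real.sin X) x + (cfc Real.sin X * cfc Real.sin X) y)) : H)

attribute [instance] HalmosModel.instNormedAddCommGroup HalmosModel.instInnerProductSpace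
  HalmosModel.instCompleteSpace

end TwoProjections

/-!
Everything is reduced to totality of eigenvectors: a normal operator is diagonalizable exactly when
only `0` is orthogonal to all of its eigenvectors (`diagonalizable_of_isStarNormal`).

*Existence of a Halmos model* (`nonempty_halmosModel`). On the generic part let `L` be the range of
`P` and `N` its nullspace, `A = P Q P` on `L` and `X = arccos √A`. The operator `T = (1 - P) Q` from
`L` to `N` satisfies `T* T = A - A² = (cos X sin X)²`. As the four special intersections are
removed, `T` and `cos X sin X` are injective with dense range, so the polar decomposition of `T` is
given by a unitary between `L` and `N`, which turns `Q` into the required matrix.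

*The equivalences.* `P Q` has a singular value decomposition exactly when `(P Q)(P Q)* = P Q P` is
diagonalizable (`schmidtDecomposable_iff`). On the generic part `P Q P` is `cos² X ⊕ 0` and the
commutator `K` is `cos X sin X [0, 1; -1, 0]`; on the four remaining subspaces both are scalar. An
eigenvector `v` of `X` therefore gives the eigenvectors `(v, 0)` of `P Q P` and `(v, ± i v)` of `K`.
Conversely, the first coordinate of an eigenvector of `P Q P` is an eigenvector of `cos² X`, hence
of `X = arccos √(cos² X)`. The first coordinate of an eigenvector of `K` is an eigenvector of
`-K² = cos² X - cos⁴ X`, a quadratic polynomial in `cos² X`, so it is a sum of two eigenvectors of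
`cos² X` (`exists_eigenvectors_add`).

*The eigenvalues of the commutator.* A pair of singular vectors `f`, `g` of `P Q` spans an invariant
subspace of `K` on which `K² = -s² (1 - s²)` and `K` has trace zero. Conversely, if `K v = μ v` with
`μ ≠ 0`, then `P v` is a nonzero eigenvector of `A - A²`, `A = P Q P`, for `-μ²`, and comparing
components along the left singular vectors gives `μ² = -s² (1 - s²)` for some singular value.
-/

namespace TwoProjections

universe u

/-! ### Diagonalization of normal operators -/

section Diagonalization

variable {H : Type u} [NormedAddCommGroup H] [InnerProductSpace ℂ H]

/-- The eigenvectors of a diagonalizable operator are total: only `0` is orthogonal to all of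
them. -/
theorem Diagonalizable.eq_zero_of_forall_inner_eq_zero {T : H →L[ℂ] H} (hT : Diagonalizable T)
    {x : H} (hx : ∀ (μ : ℂ) (v : H), T v = μ • v → ⟪v, x⟫_ℂ = 0) : x = 0 := by
  obtain ⟨ι, b, d, hb⟩ := hT
  apply b.repr.injective
  ext i
  simp [b.repr_apply_apply, hx (d i) (b i) (hb i)]

variable [CompleteSpace H]

theorem inner_eq_zero_of_isStarNormal {T : H →L[ℂ] H} (hT : IsStarNormal T) {μ ν : ℂ}
    (h : μ ≠ ν) {v w : H} (hv : T v = μ • v) (hw : T w = ν • w) : ⟪v, w⟫_ℂ = 0 := by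
  have hN : IsStarNormal (T - μ • (1 : H →L[ℂ] H)) := by
    refine ⟨?_⟩
    have h1 := hT.star_comm_self
    rw [commute_iff_eq] at h1 ⊢
    simp only [star_sub, star_smul, star_one, sub_mul, mul_sub, h1, smul_mul_assoc, mul_smul_comm,
      one_mul, mul_one, smul_sub, smul_smul, mul_comm μ]
    abel
  have h1 : ContinuousLinearMap.adjoint (T - μ • (1 : H →L[ℂ] H)) v = 0 := by
    rw [ContinuousLinearMap.IsStarNormal.adjoint_apply_eq_zero_iff hN]
    simp [hv]
  have h2 : ⟪v, (T - μ • (1 : H →L[ℂ] H)) w⟫_ℂ = 0 := by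
    rw [← ContinuousLinearMap.adjoint_inner_left, h1, inner_zero_left]
  have h3 : (T - μ • (1 : H →L[ℂ] H)) w = (ν - μ) • w := by simp [hw, sub_smul]
  rw [h3, inner_smul_right] at h2
  exact (mul_eq_zero.1 h2).resolve_left (sub_ne_zero.2 h.symm)

/-- A normal operator with a total set of eigenvectors is diagonalizable: its eigenspaces are
pairwise orthogonal, so orthonormal bases of them combine to one of the whole space. -/
theorem diagonalizable_of_isStarNormal {T : H →L[ℂ] H} (hT : IsStarNormal T)
    (h : ∀ x : H, (∀ (μ : ℂ) (v : H), T v = μ • v → ⟪v, x⟫_ℂ = 0) → x = 0) :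
    Diagonalizable T := by
  let E : ℂ → Submodule ℂ H := fun μ => (T - μ • (1 : H →L[ℂ] H)).ker
  have mem_E {μ : ℂ} {v : H} : v ∈ E μ ↔ T v = μ • v := by simp [E, sub_eq_zero]
  have hE : OrthogonalFamily ℂ (fun μ => E μ) fun μ => (E μ).subtypeₗᵢ := by
    intro μ ν hμν v w
    exact inner_eq_zero_of_isStarNormal hT hμν (mem_E.1 v.2) (mem_E.1 w.2)
  have : ∀ μ, CompleteSpace (E μ) := fun μ =>
    (ContinuousLinearMap.isClosed_ker (T - μ • (1 : H →L[ℂ] H))).completeSpace_coe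
  choose w b hb using fun μ => exists_hilbertBasis ℂ (E μ)
  have hon := hE.orthonormal_sigma_orthonormal fun μ => (b μ).orthonormal
  refine ⟨Σ μ, w μ, HilbertBasis.mkOfOrthogonalEqBot hon ?_, fun a => a.1, fun a => ?_⟩
  · rw [Submodule.eq_bot_iff]
    intro x hx
    refine h x fun μ v hv => ?_
    have hx' : ∀ a : Σ μ, w μ, ⟪((b a.1 a.2 : E a.1) : H), x⟫_ℂ = 0 := fun a =>
      (Submodule.mem_orthogonal _ _).1 hx _ (Submodule.subset_span ⟨a, rfl⟩)
    have hs := (b μ).hasSum_repr ⟨v, mem_E.2 hv⟩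
    have hs' := (hs.mapL ((innerSL ℂ x).comp (E μ).subtypeL))
    have h0 : ∀ i : w μ, ((innerSL ℂ x).comp (E μ).subtypeL)
        (((b μ).repr ⟨v, mem_E.2 hv⟩ i) • b μ i) = 0 := fun i => by
      have := inner_eq_zero_symm.1 (hx' ⟨μ, i⟩)
      simp [this]
    simp only [h0] at hs'
    exact inner_eq_zero_symm.1 (by simpa using hs'.unique hasSum_zero)
  · simpa using mem_E.1 (b a.1 a.2).2

/-- Diagonalizability passes from `T` to a normal operator `X` along an injective map `J` whose
adjoint sends every eigenvector of `T` into the closed span of the eigenvectors of `X`: if `x` is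
orthogonal to the latter, then `J x` is orthogonal to the eigenvectors of `T`. -/
theorem Diagonalizable.of_adjoint {L : Type u} [NormedAddCommGroup L] [InnerProductSpace ℂ L]
    [CompleteSpace L] {T : H →L[ℂ] H} {X : L →L[ℂ] L} (hT : Diagonalizable T)
    (hX : IsStarNormal X) {J : L →L[ℂ] H} (hJ : Function.Injective J)
    (h : ∀ (μ : ℂ) (v : H), T v = μ • v → ∀ x : L,
      (∀ (ν : ℂ) (y : L), X y = ν • y → ⟪y, x⟫_ℂ = 0) →
        ⟪ContinuousLinearMap.adjoint J v, x⟫_ℂ = 0) :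
    Diagonalizable X := by
  refine diagonalizable_of_isStarNormal hX fun x hx => hJ ?_
  rw [map_zero]
  refine hT.eq_zero_of_forall_inner_eq_zero fun μ v hv => ?_
  rw [← ContinuousLinearMap.adjoint_inner_left]
  exact h μ v hv x hx

theorem eigenvalue_eq_re {X : H →L[ℂ] H} (hX : IsSelfAdjoint X) {v : H} (hv : v ≠ 0) {μ : ℂ}
    (h : X v = μ • v) : μ = (μ.re : ℂ) := by
  have hS : (X : H →ₗ[ℂ] H).IsSymmetric := hX.isSymmetric
  have := hS.conj_eigenvalue_eq_self
    (Module.End.hasEigenvalue_of_hasEigenvector (Module.End.hasEigenvector_iff.2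
      ⟨Module.End.mem_eigenspace_iff.2 h, hv⟩))
  exact (Complex.conj_eq_iff_re.1 this).symm

/-- An eigenvector of `X` is an eigenvector of every continuous function of `X`. The property holds
for polynomials and is closed under uniform limits. -/
theorem cfc_apply_eigenvector {X : H →L[ℂ] H} (hX : IsSelfAdjoint X) {f : ℝ → ℝ}
    (hf : ContinuousOn f (spectrum ℝ X)) {v : H} {μ : ℂ} (h : X v = μ • v) :
    cfc f X v = ((f μ.re : ℝ) : ℂ) • v := by
  rcases eq_or_ne v 0 with rfl | hv
  · simp
  obtain ⟨r, rfl⟩ : ∃ r : ℝ, μ = r := ⟨_, eigenvalue_eq_re hX hv h⟩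
  rw [Complex.ofReal_re]
  have hr : r ∈ spectrum ℝ X := by
    intro hu
    have h0 : (algebraMap ℝ (H →L[ℂ] H) r - X) v = 0 := by
      simp [Algebra.algebraMap_eq_smul_one, h]
    obtain ⟨U, hU⟩ := hu
    apply hv
    have : ((U⁻¹ : (H →L[ℂ] H)ˣ) : H →L[ℂ] H) ((U : H →L[ℂ] H) v) = v := by
      rw [← mul_apply_eq_comp, Units.inv_mul, one_apply_eq_self]
    rw [← this, hU]
    change _ = _
    rw [h0, map_zero]
  have key : ∀ g : C(spectrum ℝ X, ℝ), cfcHom hX g v = ((g ⟨r, hr⟩ : ℝ) : ℂ) • v := by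
    intro g
    induction g using ContinuousMap.induction_on_of_compact with
    | const c =>
      have : (ContinuousMap.const (spectrum ℝ X) c) = algebraMap ℝ C(spectrum ℝ X, ℝ) c := rfl
      rw [this, AlgHomClass.commutes, IsScalarTower.algebraMap_apply ℝ ℂ (H →L[ℂ] H),
        Algebra.algebraMap_eq_smul_one]
      rfl
    | id => rw [cfcHom_id hX, h]; rfl
    | star_id => rw [map_star, cfcHom_id hX, hX.star_eq, h]; rfl
    | add f g hf hg => rw [map_add, add_apply, hf, hg, ContinuousMap.add_apply,
        Complex.ofReal_add, add_smul]
    | mul f g hf hg => rw [map_mul, mul_apply_eq_comp, hg, map_smul, hf, ContinuousMap.mul_apply,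
        smul_smul, Complex.ofReal_mul, mul_comm]
    | frequently f hf =>
      have hc : IsClosed {g : C(spectrum ℝ X, ℝ) | cfcHom hX g v = ((g ⟨r, hr⟩ : ℝ) : ℂ) • v} := by
        have h1 : Continuous fun g : C(spectrum ℝ X, ℝ) => cfcHom hX g v :=
          (ContinuousLinearMap.apply ℂ H v).continuous.comp (cfcHom_continuous hX)
        have h2 : Continuous fun g : C(spectrum ℝ X, ℝ) => ((g ⟨r, hr⟩ : ℝ) : ℂ) • v :=
          (Complex.continuous_ofReal.comp (continuous_eval_const _)).smul continuous_const
        exact isClosed_eq h1 h2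
      exact hc.mem_of_frequently_of_tendsto hf Filter.tendsto_id
  rw [cfc_apply f X hX hf, key]
  rfl

end Diagonalization

/-! ### Singular value decompositions -/

section Schmidt

variable {H : Type u} [NormedAddCommGroup H] [InnerProductSpace ℂ H]

theorem IsSchmidtDecomposition.apply_right {ι : Type*} {T : H →L[ℂ] H} {f g : ι → H} {s : ι → ℝ}
    (h : IsSchmidtDecomposition T f g s) (n : ι) : T (g n) = (s n : ℂ) • f n := by
  classical
  refine (h.hasSum (g n)).unique ?_
  convert! hasSum_ite_eq n ((s n : ℂ) • f n) using 2 with i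
  rw [orthonormal_iff_ite.1 h.orthonormal_right]
  split_ifs with hi
  · simp [hi]
  · simp

variable [CompleteSpace H]

theorem IsSchmidtDecomposition.adjoint_apply_left {ι : Type*} {T : H →L[ℂ] H} {f g : ι → H}
    {s : ι → ℝ} (h : IsSchmidtDecomposition T f g s) (n : ι) :
    ContinuousLinearMap.adjoint T (f n) = (s n : ℂ) • g n := by
  classical
  refine ext_inner_right ℂ fun x => ?_
  rw [ContinuousLinearMap.adjoint_inner_left, inner_smul_left, Complex.conj_ofReal]
  refine ((h.hasSum x).mapL (innerSL ℂ (f n))).unique ?_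
  convert! hasSum_ite_eq n ((s n : ℂ) * ⟪g n, x⟫_ℂ) using 2 with i
  simp only [innerSL_apply_apply, inner_smul_right, orthonormal_iff_ite.1 h.orthonormal_left]
  by_cases hi : i = n
  · simp [hi]
  · simp [hi, Ne.symm hi]

theorem IsSchmidtDecomposition.mul_adjoint_apply_left {ι : Type*} {T : H →L[ℂ] H} {f g : ι → H}
    {s : ι → ℝ} (h : IsSchmidtDecomposition T f g s) (n : ι) :
    (T * ContinuousLinearMap.adjoint T) (f n) = ((s n : ℂ) ^ 2) • f n := by
  rw [mul_apply_eq_comp, h.adjoint_apply_left, map_smul, h.apply_right, smul_smul, sq]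

/-- The range of `T` lies in the closed span of the left singular vectors. -/
theorem IsSchmidtDecomposition.adjoint_apply_eq_zero {ι : Type*} {T : H →L[ℂ] H} {f g : ι → H}
    {s : ι → ℝ} (h : IsSchmidtDecomposition T f g s) {x : H} (hx : ∀ n, ⟪f n, x⟫_ℂ = 0) :
    ContinuousLinearMap.adjoint T x = 0 := by
  refine ext_inner_right ℂ fun y => ?_
  rw [ContinuousLinearMap.adjoint_inner_left, inner_zero_left]
  refine ((h.hasSum y).mapL (innerSL ℂ x)).unique ?_
  convert! hasSum_zero (α := ℂ) (β := ι) using 2 with i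
  simp [inner_eq_zero_symm.1 (hx i)]

/-- `T` has a singular value decomposition exactly when `T T*` has an orthonormal basis of
eigenvectors: left singular vectors are the eigenvectors for nonzero eigenvalues. -/
theorem schmidtDecomposable_iff (T : H →L[ℂ] H) :
    SchmidtDecomposable T ↔ Diagonalizable (T * ContinuousLinearMap.adjoint T) := by
  constructor
  · rintro ⟨ι, f, g, s, h⟩
    have hsa : IsSelfAdjoint (T * ContinuousLinearMap.adjoint T) := IsSelfAdjoint.mul_star_self T
    refine diagonalizable_of_isStarNormal hsa.isStarNormal fun x hx => ?_
    have h0 : ContinuousLinearMap.adjoint T x = 0 :=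
      h.adjoint_apply_eq_zero fun n => hx _ _ (h.mul_adjoint_apply_left n)
    exact inner_self_eq_zero.1 (hx 0 x (by simp [h0]))
  · rintro ⟨ι, b, d, hb⟩
    have hinner (i j : ι) : ⟪ContinuousLinearMap.adjoint T (b i),
        ContinuousLinearMap.adjoint T (b j)⟫_ℂ = d j * ⟪b i, b j⟫_ℂ := by
      rw [ContinuousLinearMap.adjoint_inner_left, ← mul_apply_eq_comp, hb,
        inner_smul_right]
    have hnorm (i : ι) : d i = ((‖ContinuousLinearMap.adjoint T (b i)‖ ^ 2 : ℝ) : ℂ) := by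
      have := hinner i i
      rw [inner_self_eq_norm_sq_to_K, inner_self_eq_norm_sq_to_K, b.orthonormal.1 i] at this
      simpa using this.symm
    let σ : ι → ℝ := fun i => ‖ContinuousLinearMap.adjoint T (b i)‖
    have hσ {i : ι} (hi : d i ≠ 0) : 0 < σ i := by
      refine norm_pos_iff.2 fun h0 => hi ?_
      rw [hnorm, h0]; simp
    -- `‖T* bᵢ‖² = dᵢ`, so the normalized vectors `T* bᵢ` with `dᵢ ≠ 0` are right singular vectors.
    refine ⟨{i // d i ≠ 0}, fun i => b i,
      fun i => ((σ i : ℂ)⁻¹) • ContinuousLinearMap.adjoint T (b i), fun i => σ i,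
      b.orthonormal.comp _ Subtype.val_injective, ?_, fun i => hσ i.2, fun x => ?_⟩
    · classical
      rw [orthonormal_iff_ite]
      intro i j
      rw [inner_smul_left, inner_smul_right, hinner, orthonormal_iff_ite.1 b.orthonormal]
      have hj : (σ j : ℂ) ≠ 0 := by exact_mod_cast (hσ j.2).ne'
      by_cases hij : i = j
      · subst hij
        have : d i = (σ i : ℂ) ^ 2 := by rw [hnorm]; simp [σ]
        rw [this]
        simp
        field_simp
      · simp [hij, Subtype.coe_injective.ne hij]
    · have h1 : HasSum (fun i => ⟪ContinuousLinearMap.adjoint T (b i), x⟫_ℂ • b i) (T x) := by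
        have := b.hasSum_repr (T x)
        simpa only [b.repr_apply_apply, ← ContinuousLinearMap.adjoint_inner_left] using this
      have h2 : Function.support (fun i => ⟪ContinuousLinearMap.adjoint T (b i), x⟫_ℂ • b i) ⊆
          {i | d i ≠ 0} := by
        intro i hi h0
        apply hi
        have : ContinuousLinearMap.adjoint T (b i) = 0 := by
          have := (hnorm i).symm.trans h0
          simpa using this
        simp [this]
      convert! (hasSum_subtype_iff_of_support_subset h2).2 h1 using 2 with _ i
      have hj : (σ i : ℂ) ≠ 0 := by exact_mod_cast (hσ i.2).ne'
      simp only [Function.comp_apply, inner_smul_left, smul_smul, map_inv₀, Complex.conj_ofReal]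
      rw [mul_inv_cancel_left₀ hj]

end Schmidt

/-! ### Pairs of projections and their generic part -/

section Projections

variable {H : Type u} [NormedAddCommGroup H] [InnerProductSpace ℂ H]

theorem mem_genericPart_iff {P Q : H →L[ℂ] H} (hP : IsIdempotentElem P)
    (hQ : IsIdempotentElem Q) {x : H} :
    x ∈ genericPart P Q ↔
      (∀ u, P u = u → Q u = u → ⟪u, x⟫_ℂ = 0) ∧ (∀ u, P u = 0 → Q u = 0 → ⟪u, x⟫_ℂ = 0) ∧
      (∀ u, P u = u → Q u = 0 → ⟪u, x⟫_ℂ = 0) ∧ (∀ u, P u = 0 → Q u = u → ⟪u, x⟫_ℂ = 0) := by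
  have hr {R : H →L[ℂ] H} (hR : IsIdempotentElem R) (u : H) : u ∈ R.range ↔ R u = u := by
    refine ⟨?_, fun h => ⟨u, h⟩⟩
    rintro ⟨v, rfl⟩
    exact congrArg (fun S : H →L[ℂ] H => S v) hR.eq
  simp only [genericPart, ← Submodule.inf_orthogonal, Submodule.mem_inf,
    Submodule.mem_orthogonal, hr hP, hr hQ, LinearMap.mem_ker, ContinuousLinearMap.coe_coe,
    and_imp, and_assoc]

variable [CompleteSpace H]

theorem _root_.IsStarProjection.apply_apply {P : H →L[ℂ] H} (hP : IsStarProjection P) (x : H) :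
    P (P x) = P x :=
  congrArg (fun S : H →L[ℂ] H => S x) hP.isIdempotentElem.eq

theorem _root_.IsStarProjection.inner_left {P : H →L[ℂ] H} (hP : IsStarProjection P) (x y : H) :
    ⟪P x, y⟫_ℂ = ⟪x, P y⟫_ℂ :=
  hP.isSelfAdjoint.isSymmetric x y

theorem apply_left_mem_genericPart {P Q : H →L[ℂ] H} (hP : IsStarProjection P)
    (hQ : IsStarProjection Q) {x : H} (hx : x ∈ genericPart P Q) : P x ∈ genericPart P Q := by
  rw [mem_genericPart_iff hP.isIdempotentElem hQ.isIdempotentElem] at hx ⊢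
  obtain ⟨h1, h2, h3, h4⟩ := hx
  refine ⟨fun u hu hu' => ?_, fun u hu hu' => ?_, fun u hu hu' => ?_, fun u hu hu' => ?_⟩ <;>
    rw [← hP.inner_left, hu]
  exacts [h1 u hu hu', inner_zero_left _, h3 u hu hu', inner_zero_left _]

theorem apply_right_mem_genericPart {P Q : H →L[ℂ] H} (hP : IsStarProjection P)
    (hQ : IsStarProjection Q) {x : H} (hx : x ∈ genericPart P Q) : Q x ∈ genericPart P Q := by
  rw [mem_genericPart_iff hP.isIdempotentElem hQ.isIdempotentElem] at hx ⊢
  obtain ⟨h1, h2, h3, h4⟩ := hx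
  refine ⟨fun u hu hu' => ?_, fun u hu hu' => ?_, fun u hu hu' => ?_, fun u hu hu' => ?_⟩ <;>
    rw [← hQ.inner_left, hu']
  exacts [h1 u hu hu', inner_zero_left _, inner_zero_left _, h4 u hu hu']

theorem adjoint_mul_of_isStarProjection {P Q : H →L[ℂ] H} (hP : IsStarProjection P)
    (hQ : IsStarProjection Q) : ContinuousLinearMap.adjoint (P * Q) = Q * P := by
  rw [← ContinuousLinearMap.star_eq_adjoint, star_mul, hP.isSelfAdjoint.star_eq,
    hQ.isSelfAdjoint.star_eq]

/-- The commutator of two projections is skew-adjoint. -/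
theorem isStarNormal_commutator {P Q : H →L[ℂ] H} (hP : IsStarProjection P)
    (hQ : IsStarProjection Q) : IsStarNormal (P * Q - Q * P) := by
  refine ⟨?_⟩
  have : star (P * Q - Q * P) = -(P * Q - Q * P) := by
    rw [star_sub, star_mul, star_mul, hP.isSelfAdjoint.star_eq, hQ.isSelfAdjoint.star_eq, neg_sub]
  rw [this]
  exact (Commute.refl _).neg_left

end Projections

/-! ### Eigenvalues of the commutator -/

section Singular

variable {H : Type u} [NormedAddCommGroup H] [InnerProductSpace ℂ H] [CompleteSpace H]
  {P Q : H →L[ℂ] H} {ι : Type*} {f g : ι → H} {s : ι → ℝ}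

theorem IsSchmidtDecomposition.apply_singular (hP : IsStarProjection P) (hQ : IsStarProjection Q)
    (h : IsSchmidtDecomposition (P * Q) f g s) (n : ι) :
    P (f n) = f n ∧ Q (g n) = g n ∧ P (g n) = (s n : ℂ) • f n ∧ Q (f n) = (s n : ℂ) • g n := by
  have hs : (s n : ℂ) ≠ 0 := by exact_mod_cast (h.pos n).ne'
  have h1 : P (Q (g n)) = (s n : ℂ) • f n := h.apply_right n
  have h2 : Q (P (f n)) = (s n : ℂ) • g n := by
    have := h.adjoint_apply_left n
    rwa [adjoint_mul_of_isStarProjection hP hQ] at this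
  have hf : P (f n) = f n := by
    apply smul_right_injective H hs
    change (s n : ℂ) • P (f n) = (s n : ℂ) • f n
    rw [← map_smul, ← h1, hP.apply_apply]
  have hg : Q (g n) = g n := by
    apply smul_right_injective H hs
    change (s n : ℂ) • Q (g n) = (s n : ℂ) • g n
    rw [← map_smul, ← h2, hQ.apply_apply]
  rw [hg] at h1
  rw [hf] at h2
  exact ⟨hf, hg, h1, h2⟩

theorem IsSchmidtDecomposition.singular_le_one (hP : IsStarProjection P)
    (hQ : IsStarProjection Q) (h : IsSchmidtDecomposition (P * Q) f g s) (n : ι) : s n ≤ 1 := by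
  obtain ⟨hf, -, hg, -⟩ := h.apply_singular hP hQ n
  have h1 : ⟪f n, g n⟫_ℂ = (s n : ℂ) := by
    rw [← hf, hP.inner_left, hg, inner_smul_right, inner_self_eq_norm_sq_to_K,
      h.orthonormal_left.1 n]
    simp
  have h2 := norm_inner_le_norm (𝕜 := ℂ) (f n) (g n)
  rw [h1, h.orthonormal_left.1 n, h.orthonormal_right.1 n, Complex.norm_real] at h2
  simpa using (le_abs_self (s n)).trans h2

/-- The commutator acts on the span of a singular pair by a
traceless matrix of determinant `s² (1 - s²)`, so both square roots of `-s² (1 - s²)` are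
eigenvalues. -/
theorem IsSchmidtDecomposition.hasEigenvalue_commutator (hP : IsStarProjection P)
    (hQ : IsStarProjection Q) (h : IsSchmidtDecomposition (P * Q) f g s) (n : ι) {μ : ℂ}
    (hμ : μ ^ 2 = -((s n : ℂ) ^ 2 * (1 - (s n : ℂ) ^ 2))) :
    Module.End.HasEigenvalue (P * Q - Q * P).toLinearMap μ := by
  obtain ⟨hf, hg, hPg, hQf⟩ := h.apply_singular hP hQ n
  have hs : (s n : ℂ) ≠ 0 := by exact_mod_cast (h.pos n).ne'
  have Kf : (P * Q - Q * P) (f n) = (s n : ℂ) ^ 2 • f n - (s n : ℂ) • g n := by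
    simp only [sub_apply, mul_apply_eq_comp, hf, hQf, map_smul, hPg, smul_smul, sq]
  have Kg : (P * Q - Q * P) (g n) = (s n : ℂ) • f n - (s n : ℂ) ^ 2 • g n := by
    simp only [sub_apply, mul_apply_eq_comp, hg, hQf, map_smul, hPg, smul_smul, sq]
  by_cases h1 : (s n : ℂ) ^ 2 = 1
  · -- For `s = 1` the two singular vectors coincide and the commutator kills them.
    have h2 : s n = 1 := by
      have : (s n) ^ 2 = 1 := by exact_mod_cast h1
      nlinarith [h.pos n]
    have hfg : f n = g n := by
      have h3 : ⟪f n, g n⟫_ℂ = 1 := by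
        rw [← hf, hP.inner_left, hPg, inner_smul_right, inner_self_eq_norm_sq_to_K,
          h.orthonormal_left.1 n, h2]
        simp
      exact (inner_eq_one_iff_of_norm_eq_one (h.orthonormal_left.1 n)
        (h.orthonormal_right.1 n)).1 h3
    have hμ0 : μ = 0 := by simpa [h1] using hμ
    refine Module.End.hasEigenvalue_of_hasEigenvector (x := f n)
      (Module.End.hasEigenvector_iff.2 ⟨Module.End.mem_eigenspace_iff.2 ?_,
        h.orthonormal_left.ne_zero n⟩)
    change (P * Q - Q * P) (f n) = _
    rw [Kf, hμ0, ← hfg, h2]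
    simp
  · refine Module.End.hasEigenvalue_of_hasEigenvector
      (x := (s n : ℂ) • f n + (μ - (s n : ℂ) ^ 2) • g n)
      (Module.End.hasEigenvector_iff.2 ⟨Module.End.mem_eigenspace_iff.2 ?_, fun h0 => ?_⟩)
    · change (P * Q - Q * P) _ = _
      rw [map_add, map_smul, map_smul, Kf, Kg]
      have : μ • (μ - (s n : ℂ) ^ 2) • g n =
          (-((s n : ℂ) ^ 2 * (1 - (s n : ℂ) ^ 2)) - μ * (s n : ℂ) ^ 2) • g n := by
        rw [← hμ, smul_smul]; congr 1; ring
      rw [smul_add, this]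
      module
    · -- Applying `Q` to the vanishing combination leaves a multiple of `g n`, which forces `μ = 0`.
      have e1 := congrArg Q h0
      rw [map_add, map_smul, map_smul, hQf, hg, map_zero, smul_smul, ← add_smul] at e1
      have e2 := (smul_eq_zero.1 e1).resolve_right (h.orthonormal_right.ne_zero n)
      have hμ0 : μ = 0 := by linear_combination e2
      rw [hμ0] at hμ
      have : (s n : ℂ) ^ 2 * (1 - (s n : ℂ) ^ 2) = 0 := by linear_combination hμ
      rcases mul_eq_zero.1 this with h2 | h2
      · exact hs (pow_eq_zero_iff two_ne_zero |>.1 h2)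
      · exact h1 (sub_eq_zero.1 h2).symm

/-- The square of the commutator `K` commutes with `P`, and `P K² = -(A - A²)` with `A = P Q P`. An
eigenvector of `K` for a nonzero eigenvalue `μ` is thus mapped by `P` to an eigenvector of `A - A²`
for `-μ²`, which has a nonzero component along some left singular vector. -/
theorem IsSchmidtDecomposition.exists_of_hasEigenvalue (hP : IsStarProjection P)
    (hQ : IsStarProjection Q) (h : IsSchmidtDecomposition (P * Q) f g s) {μ : ℂ} (hμ : μ ≠ 0)
    (hK : Module.End.HasEigenvalue (P * Q - Q * P).toLinearMap μ) :
    ∃ n, μ ^ 2 = -((s n : ℂ) ^ 2 * (1 - (s n : ℂ) ^ 2)) := by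
  obtain ⟨v, hv⟩ := hK.exists_hasEigenvector
  have hv0 := hv.2
  have hKv : P (Q v) - Q (P v) = μ • v := hv.apply_eq_smul
  have e1 : P (Q v) - P (Q (P v)) = μ • P v := by
    have := congrArg P hKv
    rwa [map_sub, map_smul, hP.apply_apply] at this
  have e2 : P (Q (P (Q v))) - P (Q (P v)) = μ • P (Q v) := by
    have := congrArg (fun z => P (Q z)) hKv
    simpa only [map_sub, map_smul, hQ.apply_apply] using this
  have e3 : P (Q (P (Q v))) - P (Q (P (Q (P v)))) = μ • P (Q (P v)) := by
    have := congrArg (fun z => P (Q z)) e1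
    simpa only [map_sub, map_smul] using this
  -- `(A - A²) P v = -μ² P v`
  have key : P (Q (P v)) - P (Q (P (Q (P v)))) = -(μ ^ 2 • P v) := by
    have e4 : μ • (P (Q v) - P (Q (P v))) = μ ^ 2 • P v := by rw [e1, smul_smul, sq]
    rw [smul_sub, ← e2, ← e3] at e4
    rw [← e4]; abel
  by_contra hn
  push Not at hn
  have hadj : ∀ n, ⟪f n, P v⟫_ℂ = 0 := by
    intro n
    obtain ⟨hf, hg, hPg, hQf⟩ := h.apply_singular hP hQ n
    have hA (z : H) : ⟪f n, P z⟫_ℂ = ⟪f n, z⟫_ℂ := by rw [← hP.inner_left, hf]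
    have hB (z : H) : ⟪f n, Q z⟫_ℂ = (s n : ℂ) * ⟪g n, z⟫_ℂ := by
      rw [← hQ.inner_left, hQf, inner_smul_left, Complex.conj_ofReal]
    have hC (z : H) : ⟪g n, P z⟫_ℂ = (s n : ℂ) * ⟪f n, z⟫_ℂ := by
      rw [← hP.inner_left, hPg, inner_smul_left, Complex.conj_ofReal]
    have := congrArg (fun z => ⟪f n, z⟫_ℂ) key
    simp only [inner_sub_right, inner_neg_right, inner_smul_right, hA, hB, hC] at this
    have h0 : (μ ^ 2 + (s n : ℂ) ^ 2 * (1 - (s n : ℂ) ^ 2)) * ⟪f n, P v⟫_ℂ = 0 := by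
      rw [hA]
      linear_combination this
    refine (mul_eq_zero.1 h0).resolve_left fun h1 => hn n ?_
    linear_combination h1
  have h1 : Q (P (P v)) = 0 := by
    have := h.adjoint_apply_eq_zero hadj
    rwa [adjoint_mul_of_isStarProjection hP hQ] at this
  rw [hP.apply_apply] at h1
  rw [h1] at key
  simp only [map_zero, sub_self] at key
  have hPv : P v = 0 :=
    (smul_eq_zero.1 (neg_eq_zero.1 key.symm)).resolve_left (pow_ne_zero 2 hμ)
  rw [hPv, map_zero, sub_zero] at hKv
  rw [hPv, map_zero, map_zero, sub_zero, smul_zero] at e1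
  rw [e1] at hKv
  exact hv0 ((smul_eq_zero.1 hKv.symm).resolve_left hμ)

end Singular

/-! ### Eigenvectors of a quadratic polynomial -/

section Model

variable {L : Type u} [NormedAddCommGroup L] [InnerProductSpace ℂ L] [CompleteSpace L]

/-- Since `t - t² = ν` has at most two roots, an eigenvector of `B - B²` is a sum of two
eigenvectors of the self-adjoint operator `B`. -/
theorem exists_eigenvectors_add {B : L →L[ℂ] L} (hB : IsSelfAdjoint B) {u : L} {ν : ℂ}
    (h : B u - B (B u) = ν • u) :
    ∃ (a₁ a₂ : ℂ) (w₁ w₂ : L), B w₁ = a₁ • w₁ ∧ B w₂ = a₂ • w₂ ∧ u = w₁ + w₂ := by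
  have hBB : B (B u) = B u - ν • u := by rw [← h]; abel
  -- The two roots are `(1 ± δ) / 2`; a double root causes no Jordan block, as `B` is self-adjoint.
  obtain ⟨δ, hδ⟩ := IsAlgClosed.exists_pow_nat_eq (1 - 4 * ν) (n := 2) two_pos
  rcases eq_or_ne δ 0 with rfl | hδ0
  · have hν : ν = 1 / 4 := by linear_combination (1 / 4) * hδ
    have h0 : B u - (1 / 2 : ℂ) • u = 0 := by
      rw [← inner_self_eq_zero (𝕜 := ℂ)]
      have hs (x y : L) : ⟪B x, y⟫_ℂ = ⟪x, B y⟫_ℂ := hB.isSymmetric x y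
      have hw : B (B u - (1 / 2 : ℂ) • u) = (1 / 2 : ℂ) • (B u - (1 / 2 : ℂ) • u) := by
        rw [map_sub, map_smul, hBB, hν]; module
      rw [inner_sub_left, hs, hw, inner_smul_left, inner_smul_right]
      simp [Complex.conj_ofNat]
    exact ⟨1 / 2, 0, u, 0, sub_eq_zero.1 h0, by simp, by simp⟩
  · refine ⟨(1 + δ) / 2, (1 - δ) / 2, δ⁻¹ • (B u - ((1 - δ) / 2) • u),
      δ⁻¹ • (((1 + δ) / 2) • u - B u), ?_, ?_, ?_⟩
    · rw [map_smul, map_sub, map_smul, hBB]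
      have hν : ν = (1 - δ ^ 2) / 4 := by linear_combination (1 / 4) * hδ
      rw [hν]; module
    · rw [map_smul, map_sub, map_smul, hBB]
      have hν : ν = (1 - δ ^ 2) / 4 := by linear_combination (1 / 4) * hδ
      rw [hν]; module
    · rw [← smul_add]
      have : B u - ((1 - δ) / 2) • u + (((1 + δ) / 2) • u - B u) = δ • u := by module
      rw [this, smul_smul, inv_mul_cancel₀ hδ0, one_smul]

end Model

/-! ### Diagonalizability in a Halmos model -/

namespace HalmosModel

variable {H : Type u} [NormedAddCommGroup H] [InnerProductSpace ℂ H]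
  {P Q : H →L[ℂ] H} (M : HalmosModel P Q)

theorem isSelfAdjoint_X : IsSelfAdjoint M.X := M.X_nonneg.isSelfAdjoint

theorem mem_Icc_of_mem_spectrum {t : ℝ} (ht : t ∈ spectrum ℝ M.X) :
    t ∈ Set.Icc 0 (Real.pi / 2) := by
  refine ⟨spectrum_nonneg_of_nonneg M.X_nonneg ht, ?_⟩
  have h : M.X ≤ algebraMap ℝ (M.L →L[ℂ] M.L) (Real.pi / 2) := by
    rw [IsScalarTower.algebraMap_apply ℝ ℂ (M.L →L[ℂ] M.L), Algebra.algebraMap_eq_smul_one]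
    exact M.X_le
  exact (le_algebraMap_iff_spectrum_le M.isSelfAdjoint_X).1 h t ht

/-- The first coordinate embedding of a Halmos model into the Hilbert space. -/
noncomputable def embedFst : M.L →L[ℂ] H :=
  (genericPart P Q).subtypeL ∘L (M.W.symm : WithLp 2 (M.L × M.L) →L[ℂ] genericPart P Q) ∘L
    ((WithLp.prodContinuousLinearEquiv 2 ℂ M.L M.L).symm : M.L × M.L →L[ℂ] _) ∘L
      ContinuousLinearMap.inl ℂ M.L M.L

/-- The second coordinate embedding of a Halmos model into the Hilbert space. -/
noncomputable def embedSnd : M.L →L[ℂ] H :=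
  (genericPart P Q).subtypeL ∘L (M.W.symm : WithLp 2 (M.L × M.L) →L[ℂ] genericPart P Q) ∘L
    ((WithLp.prodContinuousLinearEquiv 2 ℂ M.L M.L).symm : M.L × M.L →L[ℂ] _) ∘L
      ContinuousLinearMap.inr ℂ M.L M.L

theorem embedFst_apply (x : M.L) :
    M.embedFst x = (M.W.symm (WithLp.toLp 2 (x, 0)) : H) := rfl

theorem embedSnd_apply (x : M.L) :
    M.embedSnd x = (M.W.symm (WithLp.toLp 2 (0, x)) : H) := rfl

theorem symm_toLp (x y : M.L) :
    (M.W.symm (WithLp.toLp 2 (x, y)) : H) = M.embedFst x + M.embedSnd y := by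
  rw [embedFst_apply, embedSnd_apply, ← Submodule.coe_add, ← map_add, ← WithLp.toLp_add]
  simp

theorem inner_embed (x y x' y' : M.L) :
    ⟪M.embedFst x + M.embedSnd y, M.embedFst x' + M.embedSnd y'⟫_ℂ = ⟪x, x'⟫_ℂ + ⟪y, y'⟫_ℂ := by
  rw [← M.symm_toLp, ← M.symm_toLp, ← Submodule.coe_inner, M.W.symm.inner_map_map,
    WithLp.prod_inner_apply]

theorem exists_eq_embed {z : H} (hz : z ∈ genericPart P Q) :
    ∃ x y, z = M.embedFst x + M.embedSnd y := by
  obtain ⟨⟨x, y⟩, hp⟩ : ∃ p : M.L × M.L, WithLp.toLp 2 p = M.W ⟨z, hz⟩ :=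
    ⟨(M.W ⟨z, hz⟩).ofLp, rfl⟩
  refine ⟨x, y, ?_⟩
  rw [← M.symm_toLp, hp, M.W.symm_apply_apply]

theorem embedFst_injective : Function.Injective M.embedFst := by
  refine (injective_iff_map_eq_zero _).2 fun x hx => ?_
  have := M.inner_embed x 0 x 0
  rw [hx] at this
  simpa using this.symm

theorem P_embed (x y : M.L) : P (M.embedFst x + M.embedSnd y) = M.embedFst x := by
  rw [← M.symm_toLp, M.P_apply]; rfl

theorem Q_embed (x y : M.L) : Q (M.embedFst x + M.embedSnd y) =
    M.embedFst ((cfc Real.cos M.X * cfc Real.cos M.X) x +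
        (cfc Real.cos M.X * cfc Real.sin M.X) y) +
      M.embedSnd ((cfc Real.cos M.X * cfc Real.sin M.X) x +
        (cfc Real.sin M.X * cfc Real.sin M.X) y) := by
  rw [← M.symm_toLp, M.Q_apply, M.symm_toLp]

/-- On the generic part, `P Q P` is `cos² X ⊕ 0`. -/
theorem mul_mul_embed (x y : M.L) : (P * Q * P) (M.embedFst x + M.embedSnd y) =
    M.embedFst ((cfc Real.cos M.X * cfc Real.cos M.X) x) := by
  have h := M.Q_embed x 0
  rw [map_zero, map_zero, map_zero, add_zero, add_zero, add_zero] at h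
  rw [mul_apply_eq_comp, mul_apply_eq_comp, M.P_embed, h, M.P_embed]

/-- On the generic part, the commutator is the matrix `cos X sin X [0, 1; -1, 0]`. -/
theorem commutator_embed (x y : M.L) : (P * Q - Q * P) (M.embedFst x + M.embedSnd y) =
    M.embedFst ((cfc Real.cos M.X * cfc Real.sin M.X) y) +
      M.embedSnd (-(cfc Real.cos M.X * cfc Real.sin M.X) x) := by
  have h := M.Q_embed x 0
  rw [map_zero, map_zero, map_zero, add_zero, add_zero, add_zero] at h
  rw [sub_apply, mul_apply_eq_comp, mul_apply_eq_comp, M.Q_embed, M.P_embed, M.P_embed, h,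
    map_add, map_neg]
  abel

theorem cos_mul_sin_mul_self :
    (cfc Real.cos M.X * cfc Real.sin M.X) * (cfc Real.cos M.X * cfc Real.sin M.X) =
      cfc Real.cos M.X * cfc Real.cos M.X -
        (cfc Real.cos M.X * cfc Real.cos M.X) * (cfc Real.cos M.X * cfc Real.cos M.X) := by
  have hX := M.isSelfAdjoint_X
  rw [← cfc_mul Real.cos Real.sin M.X, ← cfc_mul Real.cos Real.cos M.X, ← cfc_mul .., ← cfc_mul ..,
    ← cfc_sub ..]
  refine cfc_congr fun t _ => ?_
  have := Real.sin_sq_add_cos_sq t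
  change Real.cos t * Real.sin t * (Real.cos t * Real.sin t) =
    Real.cos t * Real.cos t - Real.cos t * Real.cos t * (Real.cos t * Real.cos t)
  linear_combination Real.cos t ^ 2 * this

theorem isSelfAdjoint_cos_mul_cos : IsSelfAdjoint (cfc Real.cos M.X * cfc Real.cos M.X) := by
  rw [← cfc_mul Real.cos Real.cos M.X]
  exact cfc_predicate ..

/-- The angle operator is a continuous function of `cos² X`. -/
theorem X_eq_cfc :
    M.X = cfc (fun t => Real.arccos (√t)) (cfc Real.cos M.X * cfc Real.cos M.X) := by
  have hX := M.isSelfAdjoint_X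
  have hc : Continuous fun t => Real.arccos (√t) := Real.continuous_arccos.comp Real.continuous_sqrt
  rw [← cfc_mul Real.cos Real.cos M.X, ← cfc_comp' (fun t => Real.arccos (√t)) _ M.X
    hc.continuousOn]
  conv_lhs => rw [← cfc_id ℝ M.X]
  refine cfc_congr fun t ht => ?_
  obtain ⟨h0, h1⟩ := M.mem_Icc_of_mem_spectrum ht
  change t = Real.arccos (√(Real.cos t * Real.cos t))
  rw [Real.sqrt_mul_self (Real.cos_nonneg_of_mem_Icc ⟨by linarith, h1⟩),
    Real.arccos_cos h0 (by linarith)]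

theorem X_apply_of_cos_mul_cos_apply {v : M.L} {a : ℂ}
    (h : (cfc Real.cos M.X * cfc Real.cos M.X) v = a • v) :
    M.X v = (Real.arccos (√a.re) : ℂ) • v := by
  have hc : Continuous fun t => Real.arccos (√t) := Real.continuous_arccos.comp Real.continuous_sqrt
  have := cfc_apply_eigenvector M.isSelfAdjoint_cos_mul_cos hc.continuousOn h
  rwa [← M.X_eq_cfc] at this

variable [CompleteSpace H]

theorem adjoint_embedFst_apply_mul_mul (hP : IsStarProjection P) (hQ : IsStarProjection Q)
    (v : H) : ContinuousLinearMap.adjoint M.embedFst ((P * Q * P) v) =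
      (cfc Real.cos M.X * cfc Real.cos M.X) (ContinuousLinearMap.adjoint M.embedFst v) := by
  refine ext_inner_right ℂ fun z => ?_
  have h1 : (P * Q * P) (M.embedFst z) =
      M.embedFst ((cfc Real.cos M.X * cfc Real.cos M.X) z) := by
    simpa using M.mul_mul_embed z 0
  have h2 : ⟪(cfc Real.cos M.X * cfc Real.cos M.X) (ContinuousLinearMap.adjoint M.embedFst v),
      z⟫_ℂ = ⟪ContinuousLinearMap.adjoint M.embedFst v,
        (cfc Real.cos M.X * cfc Real.cos M.X) z⟫_ℂ := M.isSelfAdjoint_cos_mul_cos.isSymmetric _ _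
  rw [h2, ContinuousLinearMap.adjoint_inner_left, ContinuousLinearMap.adjoint_inner_left, ← h1]
  simp only [mul_apply_eq_comp, hP.inner_left, hQ.inner_left]

/-- The square of the commutator acts on the first coordinate of the generic part as
`-(cos² X - cos⁴ X)`. -/
theorem adjoint_embedFst_commutator_sq (hP : IsStarProjection P) (hQ : IsStarProjection Q)
    (v : H) : ContinuousLinearMap.adjoint M.embedFst
        ((P * Q - Q * P) ((P * Q - Q * P) v)) =
      -((cfc Real.cos M.X * cfc Real.cos M.X) (ContinuousLinearMap.adjoint M.embedFst v) -
        (cfc Real.cos M.X * cfc Real.cos M.X) ((cfc Real.cos M.X * cfc Real.cos M.X)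
          (ContinuousLinearMap.adjoint M.embedFst v))) := by
  refine ext_inner_right ℂ fun z => ?_
  have hs (x y : M.L) : ⟪(cfc Real.cos M.X * cfc Real.cos M.X) x, y⟫_ℂ =
      ⟪x, (cfc Real.cos M.X * cfc Real.cos M.X) y⟫_ℂ := M.isSelfAdjoint_cos_mul_cos.isSymmetric _ _
  have hK (x y : H) : ⟪(P * Q - Q * P) x, y⟫_ℂ = -⟪x, (P * Q - Q * P) y⟫_ℂ := by
    simp only [sub_apply, mul_apply_eq_comp, inner_sub_left, inner_sub_right, hP.inner_left,
      hQ.inner_left]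
    ring
  have h1 : (P * Q - Q * P) ((P * Q - Q * P) (M.embedFst z)) =
      M.embedFst (-((cfc Real.cos M.X * cfc Real.cos M.X) z -
        (cfc Real.cos M.X * cfc Real.cos M.X) ((cfc Real.cos M.X * cfc Real.cos M.X) z))) := by
    have e1 := M.commutator_embed z 0
    have e2 := M.commutator_embed 0 (-(cfc Real.cos M.X * cfc Real.sin M.X) z)
    simp only [map_zero, add_zero, zero_add, neg_zero] at e1 e2
    rw [e1, e2, map_neg, ← mul_apply_eq_comp, M.cos_mul_sin_mul_self]
    rfl
  rw [ContinuousLinearMap.adjoint_inner_left, hK, hK, neg_neg, h1,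
    ← ContinuousLinearMap.adjoint_inner_left, inner_neg_right, inner_neg_left, inner_sub_left,
    inner_sub_right, hs, hs, hs]

/-- An eigenvector `v` of `X` gives the eigenvector `(v, 0)` of `P Q P`; the four nongeneric
subspaces and the second coordinate of the generic part consist of eigenvectors. -/
theorem mul_mul_diagonalizable (hP : IsStarProjection P) (hQ : IsStarProjection Q)
    (hX : Diagonalizable M.X) : Diagonalizable (P * Q * P) := by
  have hsa : IsSelfAdjoint (P * Q * P) := by
    rw [isSelfAdjoint_iff, star_mul, star_mul, hP.isSelfAdjoint.star_eq, hQ.isSelfAdjoint.star_eq,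
      mul_assoc]
  refine diagonalizable_of_isStarNormal hsa.isStarNormal fun z hz => ?_
  have hgen : z ∈ genericPart P Q := by
    rw [mem_genericPart_iff hP.isIdempotentElem hQ.isIdempotentElem]
    refine ⟨fun u hu hu' => hz 1 u ?_, fun u hu hu' => hz 0 u ?_, fun u hu hu' => hz 0 u ?_,
      fun u hu hu' => hz 0 u ?_⟩ <;> simp [mul_apply_eq_comp, hu, hu']
  obtain ⟨x, y, rfl⟩ := M.exists_eq_embed hgen
  have hx : x = 0 := by
    refine hX.eq_zero_of_forall_inner_eq_zero fun μ v hv => ?_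
    have hc : cfc Real.cos M.X v = (Real.cos μ.re : ℂ) • v := by
      simpa using cfc_apply_eigenvector M.isSelfAdjoint_X Real.continuous_cos.continuousOn hv
    have h1 := hz ((Real.cos μ.re : ℂ) * (Real.cos μ.re : ℂ)) (M.embedFst v) (by
      have := M.mul_mul_embed v 0
      rw [map_zero, add_zero] at this
      rw [this, mul_apply_eq_comp, hc, map_smul, hc, smul_smul, map_smul])
    simpa using (M.inner_embed v 0 x y).symm.trans (by simpa using h1)
  have h0 := hz 0 (M.embedFst x + M.embedSnd y) (by rw [M.mul_mul_embed, hx]; simp)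
  exact inner_self_eq_zero.1 h0

/-- An eigenvector `v` of `X` gives the eigenvectors `(v, ± i v)` of the commutator, which vanishes
on the four nongeneric subspaces. -/
theorem commutator_diagonalizable (hP : IsStarProjection P) (hQ : IsStarProjection Q)
    (hX : Diagonalizable M.X) : Diagonalizable (P * Q - Q * P) := by
  refine diagonalizable_of_isStarNormal (isStarNormal_commutator hP hQ) fun z hz => ?_
  have hgen : z ∈ genericPart P Q := by
    rw [mem_genericPart_iff hP.isIdempotentElem hQ.isIdempotentElem]
    refine ⟨fun u hu hu' => hz 0 u ?_, fun u hu hu' => hz 0 u ?_, fun u hu hu' => hz 0 u ?_,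
      fun u hu hu' => hz 0 u ?_⟩ <;> simp [mul_apply_eq_comp, hu, hu']
  obtain ⟨x, y, rfl⟩ := M.exists_eq_embed hgen
  have hxy (μ : ℂ) (v : M.L) (hv : M.X v = μ • v) : ⟪v, x⟫_ℂ = 0 ∧ ⟪v, y⟫_ℂ = 0 := by
    have hc : cfc Real.cos M.X v = (Real.cos μ.re : ℂ) • v := by
      simpa using cfc_apply_eigenvector M.isSelfAdjoint_X Real.continuous_cos.continuousOn hv
    have hs : cfc Real.sin M.X v = (Real.sin μ.re : ℂ) • v := by
      simpa using cfc_apply_eigenvector M.isSelfAdjoint_X Real.continuous_sin.continuousOn hv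
    have hcs : (cfc Real.cos M.X * cfc Real.sin M.X) v =
        ((Real.cos μ.re : ℂ) * (Real.sin μ.re : ℂ)) • v := by
      rw [mul_apply_eq_comp, hs, map_smul, hc, smul_smul, mul_comm]
    -- `(v, ε v)` with `ε = ± i` is an eigenvector of the commutator.
    have key (ε : ℂ) (hε : ε * ε = -1) : ⟪v, x⟫_ℂ + starRingEnd ℂ ε * ⟪v, y⟫_ℂ = 0 := by
      have h1 := hz (ε * ((Real.cos μ.re : ℂ) * (Real.sin μ.re : ℂ)))
        (M.embedFst v + M.embedSnd (ε • v)) (by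
          rw [M.commutator_embed, map_smul, hcs, smul_add, ← map_smul, ← map_smul, smul_smul,
            smul_smul]
          congr 2
          rw [← neg_smul]
          congr 1
          linear_combination -((Real.cos μ.re : ℂ) * (Real.sin μ.re : ℂ)) * hε)
      rwa [M.inner_embed, inner_smul_left] at h1
    have h1 := key Complex.I Complex.I_mul_I
    have h2 := key (-Complex.I) (by simp)
    simp only [map_neg, Complex.conj_I] at h1 h2
    refine ⟨by linear_combination (1 / 2) * h1 + (1 / 2) * h2, ?_⟩
    have h3 : Complex.I * ⟪v, y⟫_ℂ = 0 := by linear_combination (1 / 2) * h2 - (1 / 2) * h1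
    exact (mul_eq_zero.1 h3).resolve_left Complex.I_ne_zero
  have hx : x = 0 := hX.eq_zero_of_forall_inner_eq_zero fun μ v hv => (hxy μ v hv).1
  have hy : y = 0 := hX.eq_zero_of_forall_inner_eq_zero fun μ v hv => (hxy μ v hv).2
  simp [hx, hy]

theorem X_diagonalizable_of_mul_mul (hP : IsStarProjection P) (hQ : IsStarProjection Q)
    (h : Diagonalizable (P * Q * P)) : Diagonalizable M.X := by
  refine h.of_adjoint M.isSelfAdjoint_X.isStarNormal M.embedFst_injective fun μ v hv x hx =>
    hx _ _ (M.X_apply_of_cos_mul_cos_apply (a := μ) ?_)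
  rw [← M.adjoint_embedFst_apply_mul_mul hP hQ, hv, map_smul]

/-- The first coordinate of an eigenvector of the commutator is an eigenvector of
`cos² X - cos⁴ X`. It need not be one of `X`, since `cos X sin X` takes the same value at `X` and
`π / 2 - X`, but it is a sum of two of them. -/
theorem X_diagonalizable_of_commutator (hP : IsStarProjection P) (hQ : IsStarProjection Q)
    (h : Diagonalizable (P * Q - Q * P)) : Diagonalizable M.X := by
  refine h.of_adjoint M.isSelfAdjoint_X.isStarNormal M.embedFst_injective fun μ v hv x hx => ?_
  have h1 := M.adjoint_embedFst_commutator_sq hP hQ v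
  rw [hv, map_smul, hv, map_smul, map_smul, smul_smul, eq_neg_iff_add_eq_zero, add_comm,
    ← eq_neg_iff_add_eq_zero, ← neg_smul] at h1
  obtain ⟨a₁, a₂, w₁, w₂, hw₁, hw₂, hw⟩ :=
    exists_eigenvectors_add M.isSelfAdjoint_cos_mul_cos h1
  rw [hw, inner_add_left, hx _ _ (M.X_apply_of_cos_mul_cos_apply hw₁),
    hx _ _ (M.X_apply_of_cos_mul_cos_apply hw₂), add_zero]

end HalmosModel

/-! ### Existence of a Halmos model -/

section Existence

theorem denseRange_of_forall_inner_eq_zero {E F : Type*} [NormedAddCommGroup E]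
    [InnerProductSpace ℂ E] [NormedAddCommGroup F] [InnerProductSpace ℂ F] [CompleteSpace F]
    (T : E →L[ℂ] F) (h : ∀ y, (∀ x, ⟪T x, y⟫_ℂ = 0) → y = 0) : DenseRange T := by
  have h1 : (T.range)ᗮ = ⊥ := by
    rw [Submodule.eq_bot_iff]
    intro y hy
    exact h y fun x => (Submodule.mem_orthogonal _ _).1 hy _ ⟨x, rfl⟩
  have h2 := Submodule.topologicalClosure_eq_top_iff.2 h1
  exact Submodule.dense_iff_topologicalClosure_eq_top.2 h2

/-- For `0 ≤ A ≤ 1`, the operator `X = arccos √A` is the angle with `cos² X = A` and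
`sin² X = 1 - A`. -/
theorem exists_angle {L : Type u} [NormedAddCommGroup L] [InnerProductSpace ℂ L] [CompleteSpace L]
    {A : L →L[ℂ] L} (hA : 0 ≤ A) (hA1 : A ≤ 1) :
    ∃ X : L →L[ℂ] L, 0 ≤ X ∧ X ≤ ((Real.pi / 2 : ℝ) : ℂ) • (1 : L →L[ℂ] L) ∧
      cfc Real.cos X * cfc Real.cos X = A ∧ cfc Real.sin X * cfc Real.sin X = 1 - A := by
  have hsa : IsSelfAdjoint A := hA.isSelfAdjoint
  have h0 : ∀ t ∈ spectrum ℝ A, 0 ≤ t := fun t ht => spectrum_nonneg_of_nonneg hA ht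
  have h1 : ∀ t ∈ spectrum ℝ A, t ≤ 1 := by
    have : A ≤ algebraMap ℝ (L →L[ℂ] L) 1 := by rwa [map_one]
    exact (le_algebraMap_iff_spectrum_le hsa).1 this
  have hc : Continuous fun t => Real.arccos (√t) := Real.continuous_arccos.comp Real.continuous_sqrt
  have hs : ∀ t ∈ spectrum ℝ A, √t ≤ 1 := fun t ht => Real.sqrt_le_one.2 (h1 t ht)
  have hX : IsSelfAdjoint (cfc (fun t => Real.arccos (√t)) A) := cfc_predicate _ _
  refine ⟨cfc (fun t => Real.arccos (√t)) A, cfc_nonneg fun t _ => Real.arccos_nonneg _, ?_, ?_, ?_⟩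
  · have : cfc (fun t => Real.arccos (√t)) A ≤ algebraMap ℝ (L →L[ℂ] L) (Real.pi / 2) :=
      cfc_le_algebraMap _ _ _ (fun t _ => Real.arccos_le_pi_div_two.2 (Real.sqrt_nonneg t))
        hc.continuousOn
    rwa [IsScalarTower.algebraMap_apply ℝ ℂ (L →L[ℂ] L), Algebra.algebraMap_eq_smul_one] at this
  · rw [← cfc_mul Real.cos Real.cos _, ← cfc_comp' (fun t => Real.cos t * Real.cos t) _ A
      (by fun_prop) hc.continuousOn]
    conv_rhs => rw [← cfc_id ℝ A]
    refine cfc_congr fun t ht => ?_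
    change Real.cos (Real.arccos (√t)) * Real.cos (Real.arccos (√t)) = t
    rw [Real.cos_arccos (by linarith [Real.sqrt_nonneg t]) (hs t ht), Real.mul_self_sqrt (h0 t ht)]
  · rw [← cfc_mul Real.sin Real.sin _, ← cfc_comp' (fun t => Real.sin t * Real.sin t) _ A
      (by fun_prop) hc.continuousOn]
    conv_rhs => rw [← cfc_id ℝ A, ← cfc_one ℝ A, ← cfc_sub ..]
    refine cfc_congr fun t ht => ?_
    change Real.sin (Real.arccos (√t)) * Real.sin (Real.arccos (√t)) = 1 - t
    rw [Real.sin_arccos, Real.sq_sqrt (h0 t ht),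
      Real.mul_self_sqrt (by linarith [h1 t ht])]

variable {H : Type u} [NormedAddCommGroup H] [InnerProductSpace ℂ H] [CompleteSpace H]

/-- Halmos' theorem. On the generic part, let `L` be the range and `N` the nullspace of `P`. With
`A = P Q P` on `L` and `T = (1 - P) Q : L → N`, one has `T* T = A - A² = (C S)²`, and `T`, `C S` are
injective with dense range; so `C S x ↦ T x` extends to a unitary from `L` onto `N`, by which `N` is
identified with `L`. -/
theorem nonempty_halmosModel {P Q : H →L[ℂ] H} (hP : IsStarProjection P)
    (hQ : IsStarProjection Q) : Nonempty (HalmosModel P Q) := by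
  have memG {x : H} := mem_genericPart_iff hP.isIdempotentElem hQ.isIdempotentElem (x := x)
  have hGc : IsClosed (genericPart P Q : Set H) := Submodule.isClosed_orthogonal _
  let L : Submodule ℂ H := (1 - P).ker ⊓ genericPart P Q
  let N : Submodule ℂ H := P.ker ⊓ genericPart P Q
  have memL {x : H} : x ∈ L ↔ P x = x ∧ x ∈ genericPart P Q := by
    simp [L, sub_eq_zero, eq_comm (a := x)]
  have memN {x : H} : x ∈ N ↔ P x = 0 ∧ x ∈ genericPart P Q := by
    simp [N]
  have hLc : CompleteSpace L :=
    ((ContinuousLinearMap.isClosed_ker (1 - P)).inter hGc).completeSpace_coe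
  have hNc : CompleteSpace N :=
    ((ContinuousLinearMap.isClosed_ker P).inter hGc).completeSpace_coe
  have QG {x : H} (hx : x ∈ genericPart P Q) : Q x ∈ genericPart P Q :=
    apply_right_mem_genericPart hP hQ hx
  have PG {x : H} (hx : x ∈ genericPart P Q) : P x ∈ genericPart P Q :=
    apply_left_mem_genericPart hP hQ hx
  let A : L →L[ℂ] L := ((P * Q) ∘L L.subtypeL).codRestrict L fun x =>
    memL.2 ⟨hP.apply_apply _, PG (QG (memL.1 x.2).2)⟩
  let T : L →L[ℂ] N := ((Q - P * Q) ∘L L.subtypeL).codRestrict N fun x =>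
    memN.2 ⟨by simp [mul_apply_eq_comp, hP.apply_apply],
      Submodule.sub_mem _ (QG (memL.1 x.2).2) (PG (QG (memL.1 x.2).2))⟩
  have A_apply (x : L) : ((A x : L) : H) = P (Q x) := rfl
  have T_apply (x : L) : ((T x : N) : H) = Q x - P (Q x) := rfl
  have PL (x : L) : P (x : H) = x := (memL.1 x.2).1
  have PN (x : N) : P (x : H) = 0 := (memN.1 x.2).1
  -- `⟪A x, y⟫ = ⟪Q x, Q y⟫` gives both `0 ≤ A` and `⟪(1 - A) x, x⟫ = ‖x - Q x‖² ≥ 0`.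
  have inner_A (x y : L) : ⟪A x, y⟫_ℂ = ⟪Q (x : H), Q (y : H)⟫_ℂ := by
    rw [Submodule.coe_inner, A_apply, hP.inner_left, PL, ← hQ.apply_apply (x : H), hQ.inner_left,
      hQ.apply_apply]
  have hAsymm : (A : L →ₗ[ℂ] L).IsSymmetric := fun x y => by
    change ⟪A x, y⟫_ℂ = ⟪x, A y⟫_ℂ
    rw [inner_A, ← inner_conj_symm x, inner_A, inner_conj_symm]
  have hA0 : 0 ≤ A := by
    rw [ContinuousLinearMap.nonneg_iff_isPositive]
    refine ⟨hAsymm, fun x => ?_⟩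
    change 0 ≤ RCLike.re ⟪A x, x⟫_ℂ
    rw [inner_A]
    exact inner_self_nonneg
  have hA1 : A ≤ 1 := by
    rw [ContinuousLinearMap.le_def]
    refine ⟨LinearMap.IsSymmetric.sub (fun _ _ => rfl) hAsymm, fun x => ?_⟩
    have : ⟪((1 : L →L[ℂ] L) - A) x, x⟫_ℂ = ⟪(x : H) - Q x, (x : H) - Q x⟫_ℂ := by
      rw [sub_apply, inner_sub_left, inner_A, one_apply_eq_self, Submodule.coe_inner,
        inner_sub_left, inner_sub_right, inner_sub_right, hQ.inner_left, hQ.inner_left,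
        hQ.apply_apply]
      ring
    change 0 ≤ RCLike.re ⟪((1 : L →L[ℂ] L) - A) x, x⟫_ℂ
    rw [this]
    exact inner_self_nonneg
  obtain ⟨X, hX0, hX1, hCC, hSS⟩ := exists_angle hA0 hA1
  have hXsa : IsSelfAdjoint X := hX0.isSelfAdjoint
  set C := cfc Real.cos X with hC
  set S := cfc Real.sin X with hS
  have hcomm : C * S = S * C := cfc_commute_cfc _ _ _
  have hDsymm (x y : L) : ⟪(C * S) x, y⟫_ℂ = ⟪x, (C * S) y⟫_ℂ := by
    have : IsSelfAdjoint (C * S) := by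
      rw [hC, hS, ← cfc_mul Real.cos Real.sin X]
      exact cfc_predicate _ _
    exact this.isSymmetric x y
  have hDD (x : L) : (C * S) ((C * S) x) = A x - A (A x) := by
    have : (C * S) * (C * S) = A - A * A := by
      calc (C * S) * (C * S) = (C * S) * (S * C) := by rw [hcomm]
        _ = C * (S * S) * C := by simp only [mul_assoc]
        _ = C * C - C * (C * C) * C := by rw [hSS, ← hCC]; noncomm_ring
        _ = A - A * A := by simp only [← hCC, mul_assoc]
    exact congrArg (fun R : L →L[ℂ] L => R x) this
  have hAD (x : L) : A ((C * S) x) = (C * S) (A x) := by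
    have : A * (C * S) = (C * S) * A := by
      rw [← hCC]
      exact (((Commute.refl C).mul_right hcomm).mul_left ((Commute.refl C).mul_right hcomm)).eq
    exact congrArg (fun R : L →L[ℂ] L => R x) this
  have hnorm (x : L) : ‖(C * S) x‖ = ‖T x‖ := by
    have h1 : ⟪(C * S) x, (C * S) x⟫_ℂ = ⟪T x, T x⟫_ℂ := by
      rw [← hDsymm, hDD, inner_sub_left, inner_A, inner_A, Submodule.coe_inner, T_apply,
        inner_sub_left, inner_sub_right, inner_sub_right, A_apply]
      have e1 : ⟪Q (P (Q (x : H))), Q (x : H)⟫_ℂ = ⟪P (Q (x : H)), Q (x : H)⟫_ℂ := by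
        rw [hQ.inner_left, hQ.apply_apply]
      have e2 : ⟪P (Q (x : H)), P (Q (x : H))⟫_ℂ = ⟪P (Q (x : H)), Q (x : H)⟫_ℂ := by
        rw [← hP.inner_left, hP.apply_apply]
      rw [e1, e2, ← hP.inner_left]
      ring
    rw [inner_self_eq_norm_sq_to_K, inner_self_eq_norm_sq_to_K] at h1
    exact (sq_eq_sq₀ (norm_nonneg _) (norm_nonneg _)).1 (by exact_mod_cast h1)
  have Tinj (x : L) (hx : T x = 0) : x = 0 := by
    -- `T x = 0` puts `Q x` in `R(P) ∩ R(Q)`, so `Q x = 0` and `x` lies in `R(P) ∩ N(Q)`.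
    have h1 : P (Q (x : H)) = Q x := (sub_eq_zero.1 (congrArg Subtype.val hx)).symm
    have h2 : Q (x : H) = 0 :=
      inner_self_eq_zero.1 ((memG.1 (QG (memL.1 x.2).2)).1 _ h1 (hQ.apply_apply _))
    exact Subtype.ext (inner_self_eq_zero.1 ((memG.1 (memL.1 x.2).2).2.2.1 _ (PL x) h2))
  have Dinj (x : L) (hx : (C * S) x = 0) : x = 0 :=
    Tinj x (norm_eq_zero.1 (by rw [← hnorm, hx, norm_zero]))
  have Ddense : DenseRange (C * S) := denseRange_of_forall_inner_eq_zero _ fun y hy =>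
    Dinj y (inner_self_eq_zero.1 (by rw [← hDsymm]; exact hy _))
  have Tdense : DenseRange T := denseRange_of_forall_inner_eq_zero _ fun y hy => by
    -- `T* y = P Q y = 0` puts `Q y` in `N(P) ∩ R(Q)`, so `Q y = 0` and `y` lies in `N(P) ∩ N(Q)`.
    have hyG := (memN.1 y.2).2
    have h1 : P (Q (y : H)) = 0 := by
      have h2 := hy ⟨P (Q (y : H)), memL.2 ⟨hP.apply_apply _, PG (QG hyG)⟩⟩
      rw [Submodule.coe_inner, T_apply, inner_sub_left, hP.inner_left, PN, inner_zero_right,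
        sub_zero, hQ.inner_left] at h2
      rw [← inner_self_eq_zero (𝕜 := ℂ), hP.inner_left, hP.apply_apply, ← hP.inner_left]
      exact h2
    have h2 : Q (y : H) = 0 :=
      inner_self_eq_zero.1 ((memG.1 (QG hyG)).2.2.2 _ h1 (hQ.apply_apply _))
    exact Subtype.ext (inner_self_eq_zero.1 ((memG.1 hyG).2.1 _ (PN y) h2))
  -- The polar decomposition of `T`: `|T| = C S`, and `U` is the inverse of its unitary factor.
  let U : N ≃ₗᵢ[ℂ] L := (LinearEquiv.refl ℂ L).extendOfIsometry (T : L →ₗ[ℂ] N)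
    ((C * S : L →L[ℂ] L) : L →ₗ[ℂ] L) Tdense Ddense hnorm
  have U_T (x : L) : U (T x) = (C * S) x :=
    LinearEquiv.extendOfIsometry_eq (LinearEquiv.refl ℂ L) (T : L →ₗ[ℂ] N)
      ((C * S : L →L[ℂ] L) : L →ₗ[ℂ] L) Tdense Ddense hnorm x
  have U_symm (x : L) : U.symm ((C * S) x) = T x := by rw [← U_T, U.symm_apply_apply]
  have inner_LN (x : L) (y : N) : ⟪(x : H), (y : H)⟫_ℂ = 0 := by
    rw [← PL, hP.inner_left, PN, inner_zero_right]
  let V₀ : WithLp 2 (L × L) →ₗ[ℂ] genericPart P Q :=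
    { toFun := fun p => ⟨(p.fst : H) + (U.symm p.snd : H),
        Submodule.add_mem _ (memL.1 p.fst.2).2 (memN.1 (U.symm p.snd).2).2⟩
      map_add' := fun p q => Subtype.ext (by simp; abel)
      map_smul' := fun c p => Subtype.ext (by simp) }
  let V : WithLp 2 (L × L) →ₗᵢ[ℂ] genericPart P Q :=
    V₀.isometryOfInner fun p q => by
      change ⟪(p.fst : H) + (U.symm p.snd : H), (q.fst : H) + (U.symm q.snd : H)⟫_ℂ = _
      rw [inner_add_left, inner_add_right, inner_add_right, inner_LN,
        inner_eq_zero_symm.1 (inner_LN _ _), ← Submodule.coe_inner, ← Submodule.coe_inner,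
        U.symm.inner_map_map, WithLp.prod_inner_apply]
      simp
  have V_apply (x y : L) : (V (WithLp.toLp 2 (x, y)) : H) = x + (U.symm y : H) := rfl
  have Vsurj : Function.Surjective V := by
    rintro ⟨z, hz⟩
    have hL : P z ∈ L := memL.2 ⟨hP.apply_apply _, PG hz⟩
    have hN : z - P z ∈ N :=
      memN.2 ⟨by rw [map_sub, hP.apply_apply, sub_self], Submodule.sub_mem _ hz (PG hz)⟩
    refine ⟨WithLp.toLp 2 (⟨P z, hL⟩, U ⟨z - P z, hN⟩), Subtype.ext ?_⟩
    rw [V_apply, U.symm_apply_apply]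
    simp
  have QL (x : L) : Q (x : H) = A x + (U.symm ((C * S) x) : H) := by
    rw [U_symm, A_apply, T_apply]; abel
  have QN (y : N) : Q (y : H) = (C * S) (U y) + (U.symm ((S * S) (U y)) : H) := by
    -- By density, it is enough to check the identity on the range of `T`.
    refine Tdense.induction_on (p := fun y : N =>
      Q (y : H) = (C * S) (U y) + (U.symm ((S * S) (U y)) : H)) y ?_ fun x => ?_
    · exact isClosed_eq (by fun_prop) (by fun_prop)
    · have h1 : (S * S) ((C * S) x) = (C * S) (x - A x) := by
        rw [hSS, sub_apply, one_apply_eq_self, hAD, map_sub]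
      rw [U_T, hDD, h1, U_symm]
      simp only [T_apply, A_apply, Submodule.coe_sub, map_sub, hQ.apply_apply]
      abel
  -- Triviality of all three nullspaces comes from injectivity of `C S`; for `X`, note that
  -- `X x = 0` implies `sin X x = sin 0 • x = 0`.
  refine ⟨{
    L := L
    W := (LinearIsometryEquiv.ofSurjective V Vsurj).symm
    X := X
    X_nonneg := hX0
    X_le := hX1
    ker_X := ?_
    ker_cos := ?_
    ker_sin := ?_
    P_apply := ?_
    Q_apply := ?_ }⟩
  · rw [Submodule.eq_bot_iff]
    intro x hx
    have hx0 : X x = (0 : ℂ) • x := by rw [zero_smul]; exact hx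
    have h1 : S x = 0 := by
      rw [hS, cfc_apply_eigenvector hXsa Real.continuous_sin.continuousOn hx0]
      simp
    exact Dinj x (by rw [mul_apply_eq_comp, h1, map_zero])
  · rw [Submodule.eq_bot_iff]
    intro x hx
    have h1 : C x = 0 := hx
    exact Dinj x (by rw [hcomm, mul_apply_eq_comp, h1, map_zero])
  · rw [Submodule.eq_bot_iff]
    intro x hx
    have h1 : S x = 0 := hx
    exact Dinj x (by rw [mul_apply_eq_comp, h1, map_zero])
  · intro x y
    change P (V (WithLp.toLp 2 (x, y)) : H) = (V (WithLp.toLp 2 (x, 0)) : H)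
    rw [V_apply, V_apply, map_add, PL, PN, map_zero]
    simp
  · intro x y
    change Q (V (WithLp.toLp 2 (x, y)) : H) = (V (WithLp.toLp 2 ((C * C) x + (C * S) y,
      (C * S) x + (S * S) y)) : H)
    rw [V_apply, V_apply, map_add, QL, QN, U.apply_symm_apply, map_add, hCC]
    simp only [Submodule.coe_add]
    abel

end Existence

end TwoProjections

open TwoProjections in
theorem mainTheorem1 {H : Type*} [NormedAddCommGroup H] [InnerProductSpace ℂ H] [CompleteSpace H]
    (P Q : H →L[ℂ] H) (hP : IsStarProjection P) (hQ : IsStarProjection Q) :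
    Nonempty (HalmosModel P Q) ∧
    (∀ M : HalmosModel P Q,
      List.TFAE
        [SchmidtDecomposable (P * Q),
         Diagonalizable (P * Q - Q * P),
         Diagonalizable M.X]) ∧
    (∀ {ι : Type*} (f g : ι → H) (s : ι → ℝ), IsSchmidtDecomposition (P * Q) f g s →
      (∀ n, Module.End.HasEigenvalue (P * Q - Q * P).toLinearMap
          (Complex.I * ((s n * Real.sqrt (1 - s n ^ 2) : ℝ) : ℂ)) ∧
        Module.End.HasEigenvalue (P * Q - Q * P).toLinearMap
          (-(Complex.I * ((s n * Real.sqrt (1 - s n ^ 2) : ℝ) : ℂ)))) ∧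
      (∀ μ : ℂ, Module.End.HasEigenvalue (P * Q - Q * P).toLinearMap μ →
        μ = 0 ∨ ∃ n, μ = Complex.I * ((s n * Real.sqrt (1 - s n ^ 2) : ℝ) : ℂ) ∨
          μ = -(Complex.I * ((s n * Real.sqrt (1 - s n ^ 2) : ℝ) : ℂ)))) := by
  refine ⟨nonempty_halmosModel hP hQ, fun M => ?_, fun f g s h => ?_⟩
  · have hsch : SchmidtDecomposable (P * Q) ↔ Diagonalizable (P * Q * P) := by
      rw [schmidtDecomposable_iff, adjoint_mul_of_isStarProjection hP hQ, mul_assoc, ← mul_assoc Q,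
        hQ.isIdempotentElem.eq, ← mul_assoc]
    tfae_have 1 → 3 := fun h1 => M.X_diagonalizable_of_mul_mul hP hQ (hsch.1 h1)
    tfae_have 3 → 1 := fun h3 => hsch.2 (M.mul_mul_diagonalizable hP hQ h3)
    tfae_have 2 → 3 := M.X_diagonalizable_of_commutator hP hQ
    tfae_have 3 → 2 := M.commutator_diagonalizable hP hQ
    tfae_finish
  · have hsq (n) : (Complex.I * ((s n * Real.sqrt (1 - s n ^ 2) : ℝ) : ℂ)) ^ 2 =
        -((s n : ℂ) ^ 2 * (1 - (s n : ℂ) ^ 2)) := by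
      have h1 : 0 ≤ 1 - s n ^ 2 := by
        nlinarith [h.pos n, h.singular_le_one hP hQ n]
      have h2 : ((Real.sqrt (1 - s n ^ 2) : ℝ) : ℂ) ^ 2 = 1 - (s n : ℂ) ^ 2 := by
        exact_mod_cast Real.sq_sqrt h1
      rw [mul_pow, Complex.I_sq, Complex.ofReal_mul, mul_pow, h2]
      ring
    refine ⟨fun n => ⟨h.hasEigenvalue_commutator hP hQ n (hsq n),
      h.hasEigenvalue_commutator hP hQ n (by rw [neg_sq, hsq n])⟩, fun μ hμ => ?_⟩
    refine or_iff_not_imp_left.2 fun h0 => ?_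
    obtain ⟨n, hn⟩ := h.exists_of_hasEigenvalue hP hQ h0 hμ
    exact ⟨n, sq_eq_sq_iff_eq_or_eq_neg.1 (hn.trans (hsq n).symm)⟩
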